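/- On the triangular lattice with unit side and horizontal lattice lines, a \emph{lozenge} is the union of two unit triangles sharing an edge; it is \emph{vertical} if the shared edge is horizontal. Let $k\ge 1$ and $n\ge 0$ be integers. Consider the trapezoidal lattice region whose southern side has length $n+k$, whose northeastern side has length $2k-1$, whose northern side has length $n$, and whose western side is the vertical zigzag lattice path with $2k-1$ unit steps, going from the bottom to the top alternately in the north-east and the north-west direction (beginning and ending with a north-east step). Number the $n+k$ up-pointing unit triangles along the base $1,2,\dots,n+k$ from left to right, and, for integers $1\le a_1<a_2<\dots<a_k\le n+k$, remove those at the positions $a_1,\dots,a_k$. Give weight $\tfrac12$ to each vertical lozenge on the western side (that is, each vertical lozenge both of whose western sides lie on the zigzag path) and weight $1$ to every other lozenge, and call the resulting weighted region $\overline{L}_{2k-1,n}(a_1,\dots,a_k)$. Let $\operatorname{M}(\overline{L}_{2k-1,n}(a_1,\dots,a_k))$ be the sum, over all lozenge tilings of the region, of the product of the weights of the lozenges of the tiling. Then $$\operatorname{M}(\overline{L}_{2k-1,n}(a_1,\dots,a_k))=\frac{1}{\operatorname{H}_2(2k)}\prod_{1\le i<j\le k}(a_j-a_i)\prod_{1\le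 i<j\le k}(a_i+a_j-2),$$ where $\operatorname{H}_2(2k)=0!\,2!\,4!\cdots(2k-2)!$ and empty products equal $1$. -/

import Mathlib

/-!
# Lozenge tilings of weighted quartered hexagons

Points of the triangular lattice are written `(i, j) : ℤ × ℤ` in the oblique basis
`e₁ = (1, 0)`, `e₂ = (1/2, √3/2)`.  So `(i, j)` has height `j` (in units of `√3/2`) and
abscissa `i + j/2`.
-/

namespace Lozenge

/-- A unit triangle of the triangular lattice, with horizontal side.
`⟨i, j, true⟩` is the up-pointing triangle with base from `(i, j)` to `(i + 1, j)`;
`⟨i, j, false⟩` is the down-pointing triangle with upper side from `(i, j + 1)` to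
`(i + 1, j + 1)`. -/
abbrev Tri : Type := ℤ × ℤ × Bool

/-- The up-pointing unit triangle whose lower left vertex is `(i, j)`. -/
def up (i j : ℤ) : Tri := (i, j, true)

/-- The down-pointing unit triangle whose upper left vertex is `(i, j + 1)`. -/
def down (i j : ℤ) : Tri := (i, j, false)

/-- The three vertices of a unit triangle. -/
def vertices : Tri → Finset (ℤ × ℤ)
  | (i, j, true) => {(i, j), (i + 1, j), (i, j + 1)}
  | (i, j, false) => {(i + 1, j), (i, j + 1), (i + 1, j + 1)}

/-- A lozenge: the union of two unit triangles sharing an edge (that is, two vertices). -/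
def IsLozenge (L : Finset Tri) : Prop :=
  ∃ s t : Tri, (vertices s ∩ vertices t).card = 2 ∧ L = {s, t}

/-- `T` is a lozenge tiling of the region `R` (a finite set of unit triangles): a set of
lozenges contained in `R` that covers `R` without gaps or overlaps. -/
def IsTiling (R : Finset Tri) (T : Finset (Finset Tri)) : Prop :=
  (∀ L ∈ T, IsLozenge L ∧ L ⊆ R) ∧ ∀ t ∈ R, ∃! L, L ∈ T ∧ t ∈ L

open Classical in
/-- The finite set of all lozenge tilings of `R`. -/
noncomputable def tilings (R : Finset Tri) : Finset (Finset (Finset Tri)) :=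
  R.powerset.powerset.filter (IsTiling R)

theorem mem_tilings {R : Finset Tri} {T : Finset (Finset Tri)} :
    T ∈ tilings R ↔ IsTiling R T := by
  classical
  unfold tilings
  rw [Finset.mem_filter, Finset.mem_powerset]
  exact ⟨fun h => h.2, fun h =>
    ⟨fun L hL => Finset.mem_powerset.2 (h.1 L hL).2, h⟩⟩

/-- The weighted tiling count `M(R)`: the sum over all lozenge tilings of `R` of the product of
the weights of the lozenges. -/
noncomputable def weightedCount (R : Finset Tri) (wt : Finset Tri → ℚ) : ℚ :=
  ∑ T ∈ tilings R, ∏ L ∈ T, wt L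

/-- The point at height `j` of the vertical zigzag path that starts at the origin and
alternately goes one unit step to the north-east and one unit step to the north-west. Its
abscissa is `0` for even `j` and `1/2` for odd `j`. -/
def zigzag (j : ℤ) : ℤ × ℤ := (-(j / 2), j)

/-- The lattice points of the trapezoid with lower left corner at the origin, southern side of
length `n + k`, northeastern side of length `2k - 1`, northern side of length `n`, and western
side the zigzag path with `2k - 1` unit steps. -/
def InTrapezoid (k n : ℕ) (p : ℤ × ℤ) : Prop :=
  0 ≤ p.2 ∧ p.2 ≤ 2 * k - 1 ∧ (zigzag p.2).1 ≤ p.1 ∧ p.1 ≤ n + k - p.2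

instance (k n : ℕ) (p : ℤ × ℤ) : Decidable (InTrapezoid k n p) := by
  unfold InTrapezoid; infer_instance

/-- The trapezoid, as the set of its unit triangles. The box only makes finiteness
evident; see `mem_trapezoid`. -/
noncomputable def trapezoid (k n : ℕ) : Finset Tri :=
  (Finset.Icc (-(k : ℤ)) (n + k) ×ˢ Finset.Icc (0 : ℤ) (2 * k) ×ˢ Finset.univ).filter
    (fun t => ∀ p ∈ vertices t, InTrapezoid k n p)

theorem mem_trapezoid {k n : ℕ} {t : Tri} :
    t ∈ trapezoid k n ↔ ∀ p ∈ vertices t, InTrapezoid k n p := by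
  obtain ⟨i, j, b⟩ := t
  unfold trapezoid
  rw [Finset.mem_filter]
  refine ⟨fun h => h.2, fun h => ⟨?_, h⟩⟩
  cases b <;>
    simp only [vertices, InTrapezoid, zigzag, Finset.mem_insert, Finset.mem_singleton,
      forall_eq_or_imp, forall_eq, Finset.mem_product, Finset.mem_Icc, Finset.mem_univ,
      and_true] at h ⊢ <;>
    omega

/-- The quartered hexagon `L_{2k-1,n}(a₁, …, a_k)`: the trapezoid with the up-pointing unit
triangles at the positions `a₁, …, a_k` removed from its base. Position `p = 1, …, n + k`,
counted from the left, is the triangle with base from `(p - 1, 0)` to `(p, 0)`. -/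
noncomputable def quarteredHexagon (k n : ℕ) (a : Fin k → ℕ) : Finset Tri :=
  trapezoid k n \ Finset.univ.image (fun i => up ((a i : ℤ) - 1) 0)

/-- The lattice points of the western side of the trapezoid. -/
def OnWesternSide (k : ℕ) (p : ℤ × ℤ) : Prop :=
  0 ≤ p.2 ∧ p.2 ≤ 2 * k - 1 ∧ p = zigzag p.2

/-- A vertical lozenge on the western side. A vertical lozenge consists of two triangles sharing
a horizontal edge; if this edge is from `(i, j)` to `(i + 1, j)`, then the two western
sides of the lozenge run from `(i + 1, j - 1)` to `(i, j)` and from `(i, j)` to `(i, j + 1)`. -/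
def IsWesternVertical (k : ℕ) (L : Finset Tri) : Prop :=
  ∃ i j : ℤ, L = {up i j, down i (j - 1)} ∧
    OnWesternSide k (i + 1, j - 1) ∧ OnWesternSide k (i, j) ∧ OnWesternSide k (i, j + 1)

open Classical in
/-- The weight of a lozenge: `1/2` for a vertical lozenge on the western side, `1` otherwise. -/
noncomputable def weight (k : ℕ) (L : Finset Tri) : ℚ :=
  if IsWesternVertical k L then 1 / 2 else 1

/-- The skipping hyperfactorial: `0! 2! ⋯ (n-2)!` for even `n`, `1! 3! ⋯ (n-2)!` for odd `n`. -/
def H₂ : ℕ → ℕ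
  | 0 => 1
  | 1 => 1
  | n + 2 => H₂ n * n.factorial

end Lozenge

/-!
The tilings of one row are found by scanning it from left to right: between two consecutive dents
(removed up-pointing triangles) exactly one down-pointing triangle is covered by a vertical lozenge,
and this removes an up-pointing triangle from the next row. Hence the weighted count for given dents
`x` is the sum, over the sequences `y` interlacing `x`, of the weighted counts of what lies above
the row with dents `y`. By induction from the top, all these counts are determinants whose entries
are means of two consecutive binomial coefficients, as Pascal's rule makes the sums over `y`
telescope; the weight `1/2` on the western side is what makes the telescoping exact there. On the
base the entries are monic polynomials in `(a i - 1) ^ 2` divided by `(2 * j)!`, so the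
determinant is a Vandermonde determinant in the squares `(a i - 1) ^ 2`.
-/

namespace Lozenge

theorem sum_Ico_add_one_sub {M : Type*} [AddCommGroup M] (G : ℤ → M) {a b : ℤ} (hab : a ≤ b) :
    ∑ t ∈ Finset.Ico a b, (G (t + 1) - G t) = G b - G a := by
  induction b, hab using Int.leInduction with
  | base => simp
  | succ b hab ih =>
    rw [← Finset.insert_Ico_right_eq_Ico_add_one hab, Finset.sum_insert Finset.right_notMem_Ico,
      ih, sub_add_sub_cancel]

section Determinants

variable {R : Type*} [CommRing R] {m : ℕ}

theorem sum_piFinset_det (A : Fin m → Finset ℤ) (f : Fin m → ℤ → R) :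
    ∑ y ∈ Fintype.piFinset A, (Matrix.of fun i j => f j (y i)).det =
      (Matrix.of fun i j => ∑ t ∈ A i, f j t).det := by
  have h := Matrix.detRowAlternating.toMultilinearMap.map_sum_finset (fun _ t j => f j t) A
  refine h.symm.trans (congrArg Matrix.det ?_)
  ext i j
  exact Finset.sum_apply j (A i) fun t j => f j t

theorem det_cons_one (G : Fin (m + 1) → Fin m → R) :
    (Matrix.of fun i => (Fin.cons 1 (G i) : Fin (m + 1) → R)).det =
      (Matrix.of fun i j => G i.succ j - G i.castSucc j).det := by
  rw [Matrix.det_eq_of_forall_row_eq_smul_add_pred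
    (B := Matrix.of (Fin.cons (Fin.cons 1 (G 0))
      fun i => Fin.cons 0 fun j => G i.succ j - G i.castSucc j)) (fun _ => 1)]
  · rw [Matrix.det_succ_column_zero, Fin.sum_univ_succ]
    simp [Matrix.submatrix]
  · exact fun j => rfl
  · intro i j
    refine Fin.cases ?_ (fun j => ?_) j <;> simp

theorem det_cons_one_of_zero {G : Fin (m + 1) → Fin m → R} (hG : G 0 = 0) :
    (Matrix.of fun i => (Fin.cons 1 (G i) : Fin (m + 1) → R)).det =
      (Matrix.of fun i j => G i.succ j).det := by
  rw [Matrix.det_succ_row_zero, Fin.sum_univ_succ]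
  simp [hG, Matrix.submatrix]

/-- The integer sequences `y` that interlace `x`, that is, `x i ≤ y i < x (i + 1)` for all `i`. -/
noncomputable def interlacing (x : Fin (m + 1) → ℤ) : Finset (Fin m → ℤ) :=
  Fintype.piFinset fun i => Finset.Ico (x i.castSucc) (x i.succ)

theorem mem_interlacing {x : Fin (m + 1) → ℤ} {y : Fin m → ℤ} :
    y ∈ interlacing x ↔ ∀ i, x i.castSucc ≤ y i ∧ y i < x i.succ := by
  simp only [interlacing, Fintype.mem_piFinset, Finset.mem_Ico]

theorem strictMono_of_mem_interlacing {x : Fin (m + 1) → ℤ} (hx : Monotone x) {y : Fin m → ℤ}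
    (hy : y ∈ interlacing x) : StrictMono y := fun i j hij =>
  calc y i < x i.succ := (mem_interlacing.1 hy i).2
    _ ≤ x j.castSucc := hx hij
    _ ≤ y j := (mem_interlacing.1 hy j).1

theorem sum_interlacing_succ {M : Type*} [AddCommMonoid M] (x : Fin (m + 2) → ℤ)
    (F : (Fin (m + 1) → ℤ) → M) :
    ∑ y ∈ interlacing x, F y =
      ∑ t ∈ Finset.Ico (x 0) (x 1), ∑ y ∈ interlacing (Fin.tail x), F (Fin.cons t y) := by
  rw [← Finset.sum_product']
  refine (Finset.sum_equiv (Fin.consEquiv fun _ => ℤ) (fun p => ?_) fun p _ => rfl).symm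
  simp only [Finset.mem_product, Finset.mem_Ico, mem_interlacing, Fin.forall_fin_succ (n := m)]
  rfl

/-- Discrete version of integrating a determinant row by row over interlacing intervals: each row
integral is a difference of boundary values, and bordering by a column of ones collects these
differences into one determinant. -/
theorem sum_interlacing_det {x : Fin (m + 1) → ℤ} (hx : Monotone x) {f G : Fin m → ℤ → R}
    (hG : ∀ j, ∀ t ≥ x 0, f j t = G j (t + 1) - G j t) :
    ∑ y ∈ interlacing x, (Matrix.of fun i j => f j (y i)).det =
      (Matrix.of fun i => (Fin.cons 1 fun j => G j (x i) : Fin (m + 1) → R)).det := by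
  rw [interlacing, sum_piFinset_det, det_cons_one]
  congr 1
  ext i j
  have hle : x i.castSucc ≤ x i.succ := hx Fin.castSucc_lt_succ.le
  simp only [Matrix.of_apply]
  rw [← sum_Ico_add_one_sub _ hle]
  refine Finset.sum_congr rfl fun t ht => hG j t ?_
  exact (hx (Fin.zero_le _)).trans (Finset.mem_Ico.1 ht).1

theorem sum_interlacing_cons_det {l : ℤ} {y : Fin m → ℤ}
    (hy : Monotone (Fin.cons l y : Fin (m + 1) → ℤ)) {f G : Fin m → ℤ → R}
    (hl : ∀ j, G j l = 0) (hG : ∀ j, ∀ t ≥ l, f j t = G j (t + 1) - G j t) :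
    ∑ z ∈ interlacing (Fin.cons l y : Fin (m + 1) → ℤ), (Matrix.of fun i j => f j (z i)).det =
      (Matrix.of fun i j => G j (y i)).det := by
  rw [sum_interlacing_det hy hG]
  exact det_cons_one_of_zero (funext hl)

end Determinants

section Triangles

variable {i j i' j' : ℤ}

@[simp]
theorem up_inj : up i j = up i' j' ↔ i = i' ∧ j = j' := by
  simp [up]

@[simp]
theorem down_inj : down i j = down i' j' ↔ i = i' ∧ j = j' := by
  simp [down]

@[simp]
theorem up_ne_down : up i j ≠ down i' j' := by
  simp [up, down]

@[simp]
theorem down_ne_up : down i j ≠ up i' j' :=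
  up_ne_down.symm

theorem ext_up_down {A B : Finset Tri} (hup : ∀ i j, up i j ∈ A ↔ up i j ∈ B)
    (hdown : ∀ i j, down i j ∈ A ↔ down i j ∈ B) : A = B := by
  ext ⟨i, j, b⟩
  cases b
  · exact hdown i j
  · exact hup i j

/-- The three unit triangles that share an edge with a given one. -/
def neighbors : Tri → Finset Tri
  | (i, j, true) => {down i j, down (i - 1) j, down i (j - 1)}
  | (i, j, false) => {up i j, up (i + 1) j, up i (j + 1)}

theorem neighbors_up : neighbors (up i j) = {down i j, down (i - 1) j, down i (j - 1)} := rfl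

theorem neighbors_down : neighbors (down i j) = {up i j, up (i + 1) j, up i (j + 1)} := rfl

theorem notMem_neighbors_self (t : Tri) : t ∉ neighbors t := by
  obtain ⟨i, j, b⟩ := t
  cases b <;> simp [neighbors, up, down]

theorem card_vertices (t : Tri) : (vertices t).card = 3 := by
  obtain ⟨i, j, b⟩ := t
  cases b <;> exact Finset.card_eq_three.2 ⟨_, _, _, by simp, by simp, by simp, rfl⟩

theorem mem_neighbors_comm {s t : Tri} : t ∈ neighbors s ↔ s ∈ neighbors t := by
  obtain ⟨i, j, b⟩ := s
  obtain ⟨i', j', b'⟩ := t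
  cases b <;> cases b' <;>
    simp only [neighbors, up, down, Finset.mem_insert, Finset.mem_singleton, Prod.mk.injEq,
      and_true, and_false, reduceCtorEq, or_false] <;>
    omega

theorem mem_neighbors_of_card_eq_two {s t : Tri} (h : (vertices s ∩ vertices t).card = 2) :
    t ∈ neighbors s := by
  have hne : s ≠ t := by
    rintro rfl
    rw [Finset.inter_self, card_vertices] at h
    omega
  obtain ⟨⟨p₁, p₂⟩, hp, ⟨q₁, q₂⟩, hq, hpq⟩ :=
    Finset.one_lt_card.1 (h.symm ▸ one_lt_two)
  obtain ⟨i, j, b⟩ := s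
  obtain ⟨i', j', b'⟩ := t
  rw [Finset.mem_inter] at hp hq
  obtain ⟨hps, hpt⟩ := hp
  obtain ⟨hqs, hqt⟩ := hq
  cases b <;> cases b' <;>
    simp only [neighbors, up, down, vertices, Finset.mem_insert, Finset.mem_singleton,
      Prod.mk.injEq, ne_eq, and_true, and_false, reduceCtorEq, or_false]
      at hps hpt hqs hqt hpq hne ⊢ <;>
    omega

theorem card_vertices_up_inter {t : Tri} (ht : t ∈ neighbors (up i j)) :
    (vertices (up i j) ∩ vertices t).card = 2 := by
  have hpair (p q : ℤ × ℤ) (hpq : p ≠ q) (h : vertices (up i j) ∩ vertices t = {p, q}) :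
      (vertices (up i j) ∩ vertices t).card = 2 := by
    rw [h, Finset.card_pair hpq]
  simp only [neighbors_up, Finset.mem_insert, Finset.mem_singleton] at ht
  rcases ht with rfl | rfl | rfl
  · refine hpair (i + 1, j) (i, j + 1) (by simp) ?_
    grind [up, down, vertices]
  · refine hpair (i, j) (i, j + 1) (by simp) ?_
    grind [up, down, vertices]
  · refine hpair (i, j) (i + 1, j) (by simp) ?_
    grind [up, down, vertices]

theorem card_vertices_inter_eq_two_iff {s t : Tri} :
    (vertices s ∩ vertices t).card = 2 ↔ t ∈ neighbors s := by
  refine ⟨mem_neighbors_of_card_eq_two, fun h => ?_⟩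
  obtain ⟨i, j, b⟩ := s
  cases b
  · rw [Finset.inter_comm]
    have h' := mem_neighbors_comm.1 h
    simp only [neighbors, Finset.mem_insert, Finset.mem_singleton] at h
    rcases h with rfl | rfl | rfl <;> exact card_vertices_up_inter h'
  · exact card_vertices_up_inter h

end Triangles

section Tilings

variable {R : Finset Tri} {T : Finset (Finset Tri)} {L : Finset Tri} {s t : Tri}

theorem isLozenge_pair (h : s ∈ neighbors t) : IsLozenge {t, s} :=
  ⟨t, s, card_vertices_inter_eq_two_iff.2 h, rfl⟩

theorem IsLozenge.exists_eq_pair (hL : IsLozenge L) (ht : t ∈ L) :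
    ∃ s ∈ neighbors t, L = {t, s} := by
  obtain ⟨a, b, hab, rfl⟩ := hL
  rw [Finset.mem_insert, Finset.mem_singleton] at ht
  rcases ht with rfl | rfl
  · exact ⟨b, card_vertices_inter_eq_two_iff.1 hab, rfl⟩
  · rw [Finset.inter_comm] at hab
    exact ⟨a, card_vertices_inter_eq_two_iff.1 hab, Finset.pair_comm _ _⟩

theorem IsTiling.notMem_of_mem (h : IsTiling (R \ L) T) {L' : Finset Tri} (ht : t ∈ L)
    (ht' : t ∈ L') : L' ∉ T := fun hL' =>
  (Finset.mem_sdiff.1 ((h.1 L' hL').2 ht')).2 ht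

theorem IsTiling.insert (hL : IsLozenge L) (hLR : L ⊆ R) (h : IsTiling (R \ L) T) :
    IsTiling R (insert L T) := by
  refine ⟨fun L' hL' => ?_, fun t ht => ?_⟩
  · rcases Finset.mem_insert.1 hL' with rfl | hL'
    · exact ⟨hL, hLR⟩
    · exact ⟨(h.1 L' hL').1, (h.1 L' hL').2.trans Finset.sdiff_subset⟩
  · by_cases htL : t ∈ L
    · refine ⟨L, ⟨Finset.mem_insert_self _ _, htL⟩, fun L' ⟨hL', htL'⟩ => ?_⟩
      exact (Finset.mem_insert.1 hL').resolve_right (h.notMem_of_mem htL htL')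
    · obtain ⟨L', ⟨hL', htL'⟩, hunique⟩ := h.2 t (Finset.mem_sdiff.2 ⟨ht, htL⟩)
      refine ⟨L', ⟨Finset.mem_insert_of_mem hL', htL'⟩, fun L'' ⟨hL'', htL''⟩ => ?_⟩
      rcases Finset.mem_insert.1 hL'' with rfl | hL''
      · exact absurd htL'' htL
      · exact hunique L'' ⟨hL'', htL''⟩

theorem IsTiling.erase (h : IsTiling R T) (hL : L ∈ T) : IsTiling (R \ L) (T.erase L) := by
  refine ⟨fun L' hL' => ?_, fun t ht => ?_⟩
  · obtain ⟨hne, hL'⟩ := Finset.mem_erase.1 hL'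
    refine ⟨(h.1 L' hL').1, fun t ht => Finset.mem_sdiff.2 ⟨(h.1 L' hL').2 ht, fun htL => hne ?_⟩⟩
    exact (h.2 t ((h.1 L hL).2 htL)).unique ⟨hL', ht⟩ ⟨hL, htL⟩
  · obtain ⟨htR, htL⟩ := Finset.mem_sdiff.1 ht
    obtain ⟨L', ⟨hL', htL'⟩, hunique⟩ := h.2 t htR
    have hne : L' ≠ L := fun h => htL (h ▸ htL')
    exact ⟨L', ⟨Finset.mem_erase.2 ⟨hne, hL'⟩, htL'⟩,
      fun L'' hL'' => hunique L'' ⟨Finset.mem_of_mem_erase hL''.1, hL''.2⟩⟩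

theorem weightedCount_eq_sum_neighbors (wt : Finset Tri → ℚ) (ht : t ∈ R) :
    weightedCount R wt =
      ∑ s ∈ neighbors t, if s ∈ R then wt {t, s} * weightedCount (R \ {t, s}) wt else 0 := by
  simp_rw [← Finset.sum_filter, weightedCount, Finset.mul_sum]
  rw [Finset.sum_sigma']
  symm
  refine Finset.sum_bij (fun p _ => insert {t, p.1} p.2) ?_ ?_ ?_ ?_
  · rintro ⟨s, T⟩ h
    simp only [Finset.mem_sigma, Finset.mem_filter, mem_tilings] at h ⊢
    obtain ⟨⟨hs, hsR⟩, hT⟩ := h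
    have hsub := Finset.insert_subset ht (Finset.singleton_subset_iff.2 hsR)
    exact hT.insert (isLozenge_pair hs) hsub
  · rintro ⟨s, T⟩ h ⟨s', T'⟩ h' heq
    simp only [Finset.mem_sigma, Finset.mem_filter, mem_tilings] at h h' heq
    have hnotMem (u : Tri) : {t, u} ∉ T ∧ {t, u} ∉ T' :=
      have htu := Finset.mem_insert_self t {u}
      ⟨h.2.notMem_of_mem (Finset.mem_insert_self _ _) htu,
        h'.2.notMem_of_mem (Finset.mem_insert_self _ _) htu⟩
    have hpair : ({t, s} : Finset Tri) = {t, s'} :=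
      (Finset.mem_insert.1 (heq ▸ Finset.mem_insert_self _ _)).resolve_right (hnotMem s).2
    have hs : s ∉ ({t} : Finset Tri) := by
      rw [Finset.mem_singleton]
      rintro rfl
      exact notMem_neighbors_self _ h.1.1
    rw [Finset.pair_comm t, Finset.pair_comm t, Finset.insert_inj hs] at hpair
    obtain rfl := hpair
    rw [← Finset.erase_insert (hnotMem s).1, heq, Finset.erase_insert (hnotMem s).2]
  · intro T hT
    rw [mem_tilings] at hT
    obtain ⟨L, ⟨hL, htL⟩, -⟩ := hT.2 t ht
    obtain ⟨s, hs, rfl⟩ := (hT.1 L hL).1.exists_eq_pair htL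
    refine ⟨⟨s, T.erase {t, s}⟩, ?_, Finset.insert_erase hL⟩
    simp only [Finset.mem_sigma, Finset.mem_filter, mem_tilings]
    exact ⟨⟨hs, (hT.1 _ hL).2 (by simp)⟩, hT.erase hL⟩
  · rintro ⟨s, T⟩ h
    simp only [Finset.mem_sigma, mem_tilings] at h
    have htL := Finset.mem_insert_self t {s}
    rw [Finset.prod_insert (h.2.notMem_of_mem htL htL)]

theorem tilings_empty : tilings ∅ = {∅} := by
  ext T
  rw [mem_tilings, Finset.mem_singleton]
  refine ⟨fun h => Finset.eq_empty_of_forall_notMem fun L hL => ?_, ?_⟩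
  · obtain ⟨⟨s, t, -, rfl⟩, hsub⟩ := h.1 L hL
    exact Finset.notMem_empty s (hsub (Finset.mem_insert_self s {t}))
  · rintro rfl
    exact ⟨by simp, by simp⟩

theorem weightedCount_empty (wt : Finset Tri → ℚ) : weightedCount ∅ wt = 1 := by
  simp [weightedCount, tilings_empty]

end Tilings

section Scan

/-- The part of the region `R` above height `r`, with the up-pointing triangles (dents) standing on
height `r` at the positions in `S` removed. -/
def above (R : Finset Tri) (r : ℤ) (S : Finset ℤ) : Finset Tri :=
  R.filter fun t => r ≤ t.2.1 ∧ ∀ i ∈ S, t ≠ up i r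

/-- The index of a triangle when the triangles of its row, which are alternately up-pointing and
down-pointing, are numbered from left to right. -/
def rowIndex : Tri → ℤ
  | (i, _, true) => 2 * i
  | (i, _, false) => 2 * i + 1

/-- What is left of `above R r S` once the triangles of row `r` with index less than `p` are
covered, where the vertical lozenges used for this cover the up-pointing triangles of row `r + 1`
at the positions in `T`. -/
def scan (R : Finset Tri) (r : ℤ) (S : Finset ℤ) (p : ℤ) (T : Finset ℤ) : Finset Tri :=
  (above R r S).filter fun t => (t.2.1 = r → p ≤ rowIndex t) ∧ ∀ i ∈ T, t ≠ up i (r + 1)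

/-- Row `r` of `R` ends with the up-pointing triangle at position `e`, and it contains all
triangles between the up-pointing ones at positions `l` and `e`. -/
def IsRow (R : Finset Tri) (r l e : ℤ) : Prop :=
  ∀ i ≥ l, (down i r ∈ R ↔ i < e) ∧ (up (i + 1) r ∈ R ↔ i < e)

/-- The weight of the vertical lozenge formed by the down-pointing triangle of row `r` and the
up-pointing triangle of row `r + 1` at position `c`, or `0` if the latter is not in `R`. -/
def verticalWeight (R : Finset Tri) (wt : Finset Tri → ℚ) (r c : ℤ) : ℚ :=
  if up c (r + 1) ∈ R then wt {down c r, up c (r + 1)} else 0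

variable {R : Finset Tri} {wt : Finset Tri → ℚ} {r l e p i j c : ℤ} {S T : Finset ℤ}

theorem up_mem_above : up i j ∈ above R r S ↔ up i j ∈ R ∧ r ≤ j ∧ (j = r → i ∉ S) := by
  rw [above, Finset.mem_filter]
  grind [up]

theorem down_mem_above : down i j ∈ above R r S ↔ down i j ∈ R ∧ r ≤ j := by
  simp [above, down_ne_up, show (down i j).2.1 = j from rfl]

theorem up_mem_scan : up i j ∈ scan R r S p T ↔
    up i j ∈ R ∧ r ≤ j ∧ (j = r → p ≤ 2 * i ∧ i ∉ S) ∧ (j = r + 1 → i ∉ T) := by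
  rw [scan, Finset.mem_filter, up_mem_above]
  grind [up, rowIndex]

theorem down_mem_scan : down i j ∈ scan R r S p T ↔
    down i j ∈ R ∧ r ≤ j ∧ (j = r → p ≤ 2 * i + 1) := by
  rw [scan, Finset.mem_filter, down_mem_above]
  grind [up, down, rowIndex]

theorem scan_empty_eq_above (hup : ∀ i, up i r ∈ R → i ∉ S → p ≤ 2 * i)
    (hdown : ∀ i, down i r ∈ R → p ≤ 2 * i + 1) : scan R r S p ∅ = above R r S := by
  refine ext_up_down (fun i j => ?_) fun i j => ?_
  · rw [up_mem_scan, up_mem_above]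
    grind
  · rw [down_mem_scan, down_mem_above]
    grind

theorem scan_eq_above_add_one (hR : IsRow R r l e) (hle : l ≤ e) :
    scan R r S (2 * e + 1) T = above R (r + 1) T := by
  refine ext_up_down (fun i j => ?_) fun i j => ?_
  · rw [up_mem_scan, up_mem_above]
    have := hR (i - 1)
    grind
  · rw [down_mem_scan, down_mem_above]
    have := hR i
    grind

theorem scan_two_mul_of_mem (hc : c ∈ S) :
    scan R r S (2 * c) T = scan R r S (2 * c + 1) T := by
  refine ext_up_down (fun i j => ?_) fun i j => ?_
  · rw [up_mem_scan, up_mem_scan]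
    grind
  · rw [down_mem_scan, down_mem_scan]
    grind

theorem scan_sdiff_up_down :
    scan R r S (2 * c) T \ {up c r, down c r} = scan R r S (2 * (c + 1)) T := by
  refine ext_up_down (fun i j => ?_) fun i j => ?_
  · simp only [Finset.mem_sdiff, up_mem_scan, Finset.mem_insert, Finset.mem_singleton, up_inj,
      up_ne_down]
    grind
  · simp only [Finset.mem_sdiff, down_mem_scan, Finset.mem_insert, Finset.mem_singleton, down_inj,
      down_ne_up]
    grind

theorem scan_sdiff_down_up :
    scan R r S (2 * c + 1) T \ {down c r, up (c + 1) r} = scan R r S (2 * (c + 1) + 1) T := by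
  refine ext_up_down (fun i j => ?_) fun i j => ?_
  · simp only [Finset.mem_sdiff, up_mem_scan, Finset.mem_insert, Finset.mem_singleton, up_inj,
      up_ne_down]
    grind
  · simp only [Finset.mem_sdiff, down_mem_scan, Finset.mem_insert, Finset.mem_singleton, down_inj,
      down_ne_up]
    grind

theorem scan_sdiff_vertical :
    scan R r S (2 * c + 1) T \ {down c r, up c (r + 1)} =
      scan R r S (2 * (c + 1)) (insert c T) := by
  refine ext_up_down (fun i j => ?_) fun i j => ?_
  · simp only [Finset.mem_sdiff, up_mem_scan, Finset.mem_insert, Finset.mem_singleton, up_inj,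
      up_ne_down]
    grind
  · simp only [Finset.mem_sdiff, down_mem_scan, Finset.mem_insert, Finset.mem_singleton, down_inj,
      down_ne_up]
    grind

theorem weightedCount_scan_two_mul (hwt : ∀ i j, wt {up i r, down j r} = 1) (hc : up c r ∈ R)
    (hcS : c ∉ S) :
    weightedCount (scan R r S (2 * c) T) wt =
      if down c r ∈ R then weightedCount (scan R r S (2 * (c + 1)) T) wt else 0 := by
  have hup : up c r ∈ scan R r S (2 * c) T := by
    rw [up_mem_scan]
    grind
  have h₁ : down c r ∈ scan R r S (2 * c) T ↔ down c r ∈ R := by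
    rw [down_mem_scan]
    grind
  have h₂ : down (c - 1) r ∉ scan R r S (2 * c) T := by
    rw [down_mem_scan]
    grind
  have h₃ : down c (r - 1) ∉ scan R r S (2 * c) T := by
    rw [down_mem_scan]
    grind
  have hne (i : ℤ) : i ≠ i - 1 := (sub_one_lt i).ne'
  rw [weightedCount_eq_sum_neighbors wt hup, neighbors_up, Finset.sum_insert (by simp [hne]),
    Finset.sum_pair (by simp [hne]), if_neg h₂, if_neg h₃, hwt, scan_sdiff_up_down]
  simp only [h₁, one_mul, add_zero]

theorem weightedCount_scan_two_mul_add_one (hwt : ∀ i j, wt {up i r, down j r} = 1)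
    (hc : down c r ∈ R) (hcT : c ∉ T) :
    weightedCount (scan R r S (2 * c + 1) T) wt =
      (if up (c + 1) r ∈ R ∧ c + 1 ∉ S then
        weightedCount (scan R r S (2 * (c + 1) + 1) T) wt else 0) +
      verticalWeight R wt r c * weightedCount (scan R r S (2 * (c + 1)) (insert c T)) wt := by
  have hdown : down c r ∈ scan R r S (2 * c + 1) T := by
    rw [down_mem_scan]
    grind
  have h₁ : up c r ∉ scan R r S (2 * c + 1) T := by
    rw [up_mem_scan]
    grind
  have h₂ : up (c + 1) r ∈ scan R r S (2 * c + 1) T ↔ up (c + 1) r ∈ R ∧ c + 1 ∉ S := by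
    rw [up_mem_scan]
    grind
  have h₃ : up c (r + 1) ∈ scan R r S (2 * c + 1) T ↔ up c (r + 1) ∈ R := by
    rw [up_mem_scan]
    grind
  rw [weightedCount_eq_sum_neighbors wt hdown, neighbors_down, Finset.sum_insert (by simp),
    Finset.sum_pair (by simp), if_neg h₁, scan_sdiff_down_up, scan_sdiff_vertical,
    Finset.pair_comm _ (up (c + 1) r), hwt, verticalWeight, ite_mul, zero_mul]
  simp only [h₂, h₃, one_mul, zero_add]

end Scan

section Branching

variable {R : Finset Tri} {wt : Finset Tri → ℚ} {r l e : ℤ} {S : Finset ℤ}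

theorem IsRow.up_mem {i : ℤ} (hR : IsRow R r l e) (hl : l < i) (he : i ≤ e) : up i r ∈ R := by
  simpa only [sub_add_cancel] using (hR (i - 1) (by omega)).2.2 (by omega)

theorem weightedCount_scan_eq_zero {c : ℤ} {T : Finset ℤ} (hwt : ∀ i j, wt {up i r, down j r} = 1)
    (hR : IsRow R r l e) (hc : l < c) (hce : c ≤ e) (hS : ∀ i ≥ c, i ∉ S) :
    weightedCount (scan R r S (2 * c) T) wt = 0 := by
  rw [weightedCount_scan_two_mul hwt (hR.up_mem hc hce) (hS c le_rfl), ite_eq_right_iff,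
    (hR c hc.le).1]
  exact fun hlt => weightedCount_scan_eq_zero hwt hR (by omega) hlt fun i hi => hS i (by omega)
termination_by (e - c).toNat

theorem weightedCount_scan_skip {c s : ℤ} {T : Finset ℤ} (hwt : ∀ i j, wt {up i r, down j r} = 1)
    (hcs : c ≤ s) (hsS : s ∈ S)
    (hgap : ∀ i, c ≤ i → i < s → up i r ∈ R ∧ down i r ∈ R ∧ i ∉ S) :
    weightedCount (scan R r S (2 * c) T) wt = weightedCount (scan R r S (2 * s + 1) T) wt := by
  obtain rfl | hlt := hcs.eq_or_lt
  · rw [scan_two_mul_of_mem hsS]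
  obtain ⟨hup, hdown, hcS⟩ := hgap c le_rfl hlt
  rw [weightedCount_scan_two_mul hwt hup hcS, if_pos hdown]
  exact weightedCount_scan_skip hwt hlt hsS fun i hi => hgap i (by omega)
termination_by (s - c).toNat

theorem weightedCount_scan_of_forall_gt {c : ℤ} {T : Finset ℤ}
    (hwt : ∀ i j, wt {up i r, down j r} = 1) (hR : IsRow R r l e) (hc : l ≤ c) (hce : c ≤ e)
    (hS : ∀ i > c, i ∉ S) (hT : ∀ t ∈ T, t < c) :
    weightedCount (scan R r S (2 * c + 1) T) wt = weightedCount (above R (r + 1) T) wt := by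
  obtain rfl | hlt := hce.eq_or_lt
  · rw [scan_eq_above_add_one hR hc]
  rw [weightedCount_scan_two_mul_add_one hwt ((hR c hc).1.2 hlt) fun h => (hT c h).false,
    if_pos ⟨(hR c hc).2.2 hlt, hS _ (lt_add_one c)⟩,
    weightedCount_scan_eq_zero hwt hR (by omega) hlt hS, mul_zero, add_zero]
  exact weightedCount_scan_of_forall_gt hwt hR (by omega) hlt (fun i hi => hS i (by omega))
    fun t ht => (hT t ht).trans (lt_add_one c)
termination_by (e - c).toNat

theorem weightedCount_scan_eq_sum {c s : ℤ} {T : Finset ℤ}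
    (hwt : ∀ i j, wt {up i r, down j r} = 1) (hR : IsRow R r l e) (hc : l ≤ c) (hcs : c < s)
    (hse : s ≤ e) (hsS : s ∈ S) (hS : ∀ i, c < i → i < s → i ∉ S) (hT : ∀ t ∈ T, t < c) :
    weightedCount (scan R r S (2 * c + 1) T) wt =
      ∑ t ∈ Finset.Ico c s, verticalWeight R wt r t *
        weightedCount (scan R r S (2 * s + 1) (insert t T)) wt := by
  have hlt : c < e := by omega
  rw [weightedCount_scan_two_mul_add_one hwt ((hR c hc).1.2 hlt) fun h => (hT c h).false,
    weightedCount_scan_skip hwt hcs hsS fun i hci his =>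
      ⟨hR.up_mem (by omega) (by omega), (hR i (by omega)).1.2 (by omega), hS i hci his⟩,
    ← Finset.insert_Ico_add_one_left_eq_Ico hcs, Finset.sum_insert (by simp), add_comm]
  congr 1
  obtain rfl | hne := eq_or_ne (c + 1) s
  · simp [hsS]
  · rw [if_pos ⟨(hR c hc).2.2 hlt, hS _ (lt_add_one c) (by omega)⟩]
    exact weightedCount_scan_eq_sum hwt hR (by omega) (by omega) hse hsS
      (fun i hi => hS i (by omega)) fun t ht => (hT t ht).trans (lt_add_one c)
termination_by (s - c).toNat

theorem weightedCount_scan_eq_sum_interlacing {m : ℕ} {x : Fin (m + 1) → ℤ} {T : Finset ℤ}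
    (hwt : ∀ i j, wt {up i r, down j r} = 1) (hx : StrictMono x) (hR : IsRow R r (x 0) e)
    (hxe : x (Fin.last m) ≤ e) (hS : ∀ i > x 0, i ∈ S ↔ i ∈ Set.range x)
    (hT : ∀ t ∈ T, t < x 0) :
    weightedCount (scan R r S (2 * x 0 + 1) T) wt =
      ∑ y ∈ interlacing x, (∏ i, verticalWeight R wt r (y i)) *
        weightedCount (above R (r + 1) (T ∪ Finset.univ.image y)) wt := by
  induction m generalizing T with
  | zero =>
    have hS' : ∀ i > x 0, i ∉ S := fun i hi h => hi.ne (by simpa using (hS i hi).1 h)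
    rw [weightedCount_scan_of_forall_gt hwt hR le_rfl hxe hS' hT]
    simp [interlacing]
  | succ m ih =>
    have h01 : x 0 < x 1 := hx Fin.zero_lt_one
    have h1 : x 1 ≤ e := (hx.monotone (Fin.le_last 1)).trans hxe
    have hmem : x 1 ∈ S := (hS _ h01).2 ⟨1, rfl⟩
    have hgap : ∀ i, x 0 < i → i < x 1 → i ∉ S := by
      intro i h0 h1 h
      obtain ⟨j, rfl⟩ := (hS i h0).1 h
      rw [(Fin.lt_one_iff j).1 (hx.lt_iff_lt.1 h1)] at h0
      exact h0.false
    rw [weightedCount_scan_eq_sum hwt hR le_rfl h01 h1 hmem hgap hT, sum_interlacing_succ]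
    refine Finset.sum_congr rfl fun t ht => ?_
    have hRtail : IsRow R r (Fin.tail x 0) e := fun i hi => hR i (h01.le.trans hi)
    have hStail : ∀ i > Fin.tail x 0, i ∈ S ↔ i ∈ Set.range (Fin.tail x) := by
      intro i hi
      rw [hS i (h01.trans hi)]
      simp only [Set.mem_range, Fin.exists_fin_succ, (h01.trans hi).ne, false_or]
      rfl
    have hTt : ∀ u ∈ insert t T, u < Fin.tail x 0 := by
      rw [Finset.forall_mem_insert]
      exact ⟨(Finset.mem_Ico.1 ht).2, fun u hu => (hT u hu).trans h01⟩
    refine (congrArg _ (ih (hx.comp Fin.strictMono_succ) hRtail hxe hStail hTt)).trans ?_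
    rw [Finset.mul_sum]
    refine Finset.sum_congr rfl fun y _ => ?_
    have himage : (Finset.univ.image (Fin.cons t y : Fin (m + 1) → ℤ)) =
        insert t (Finset.univ.image y) := by
      simp [← Finset.coe_inj, Fin.range_cons]
    rw [Fin.prod_univ_succ, mul_assoc, himage, Finset.union_insert, ← Finset.insert_union]
    rfl

end Branching

section BinomialRing

variable {R : Type*} [CommRing R] [BinomialRing R]

theorem add_one_mul_choose_eq_mul_choose_sub_one (x : R) (N : ℕ) :
    (N + 1) * Ring.choose x (N + 1) = x * Ring.choose (x - 1) N := by
  simpa using Ring.choose_smul_choose x (Nat.le_add_left 1 N)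

theorem add_one_mul_choose_eq_sub_mul_choose (x : R) (N : ℕ) :
    (N + 1) * Ring.choose x (N + 1) = (x - N) * Ring.choose x N := by
  simpa [mul_comm] using Ring.choose_smul_choose x (Nat.le_succ N)

end BinomialRing

section MeanChoose

variable {K : Type*} [Field K] [CharZero K]

/-- The mean of two consecutive binomial coefficients, `(C(x, N) + C(x - 1, N)) / 2`. The tiling
counts of the parts of the quartered hexagon above a given height are determinants of these. -/
noncomputable def meanChoose (x : K) (N : ℕ) : K :=
  (Ring.choose x N + Ring.choose (x - 1) N) / 2

@[simp]
theorem meanChoose_zero_right (x : K) : meanChoose x 0 = 1 := by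
  simp [meanChoose]

theorem meanChoose_add_one_sub (x : K) (N : ℕ) :
    meanChoose (x + 1) (N + 1) - meanChoose x (N + 1) = meanChoose x N := by
  have h₀ := Ring.choose_succ_succ x N
  have h₁ := Ring.choose_succ_succ (x - 1) N
  rw [sub_add_cancel] at h₁
  rw [meanChoose, meanChoose, meanChoose, add_sub_cancel_right]
  linear_combination (h₀ + h₁) / 2

theorem meanChoose_natCast_add_one (j : ℕ) :
    meanChoose (j + 1 : K) (2 * j + 1) = meanChoose (j : K) (2 * j) / 2 := by
  rcases j with _ | j
  · simp [meanChoose]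
  · have hchoose {a N : ℕ} (haN : a < N) : Ring.choose (a : K) N = 0 := by
      rw [Ring.choose_natCast, Nat.choose_eq_zero_of_lt haN, Nat.cast_zero]
    have h₀ : ((j + 1 : ℕ) + 1 : K) = (j + 2 : ℕ) := by push_cast; ring
    have h₁ : ((j + 2 : ℕ) - 1 : K) = (j + 1 : ℕ) := by push_cast; ring
    have h₂ : ((j + 1 : ℕ) - 1 : K) = j := by push_cast; ring
    rw [h₀, meanChoose, meanChoose, h₁, h₂, hchoose (by omega), hchoose (by omega),
      hchoose (by omega), hchoose (by omega)]
    simp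

theorem sum_interlacing_det_meanChoose {m : ℕ} {x : Fin (m + 1) → ℤ} (hx : Monotone x) (c : K) :
    ∑ y ∈ interlacing x,
        (Matrix.of fun i j : Fin m => meanChoose ((y i : K) + (c + 1) + (j : ℕ)) (2 * j + 1)).det =
      (Matrix.of fun i j : Fin (m + 1) => meanChoose ((x i : K) + c + (j : ℕ)) (2 * j)).det := by
  let f (j : Fin m) (t : ℤ) : K := meanChoose ((t : K) + (c + 1) + (j : ℕ)) (2 * j + 1)
  let G (j : Fin m) (t : ℤ) : K := meanChoose ((t : K) + c + (j.succ : ℕ)) (2 * (j.succ : ℕ))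
  have hdiff (j : Fin m) (t : ℤ) (_ : t ≥ x 0) : f j t = G j (t + 1) - G j t := by
    have hshift : ((t + 1 : ℤ) : K) + c + (j.succ : ℕ) = (t + c + (j.succ : ℕ)) + 1 := by
      push_cast
      ring
    simp only [f, G, hshift]
    rw [Fin.val_succ, mul_add_one, meanChoose_add_one_sub]
    congr 1
    push_cast
    ring
  refine (sum_interlacing_det hx hdiff).trans (congrArg Matrix.det ?_)
  ext i j
  refine Fin.cases ?_ (fun j => rfl) j
  simp

/-- Halving the summand at the left end `l` turns it into the boundary term that is missing from
the telescoping sum. -/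
theorem sum_interlacing_cons_det_meanChoose {m : ℕ} {l : ℤ} {y : Fin m → ℤ}
    (hy : StrictMono (Fin.cons l y : Fin (m + 1) → ℤ)) :
    ∑ z ∈ interlacing (Fin.cons l y : Fin (m + 1) → ℤ), (∏ i, if z i = l then 1 / 2 else 1) *
        (Matrix.of fun i j : Fin m => meanChoose ((z i : K) - l + (j : ℕ)) (2 * j)).det =
      (Matrix.of fun i j : Fin m => meanChoose ((y i : K) - l + (j : ℕ)) (2 * j + 1)).det := by
  let f (j : Fin m) (t : ℤ) : K :=
    (if t = l then 1 / 2 else 1) * meanChoose ((t : K) - l + (j : ℕ)) (2 * j)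
  let G (j : Fin m) (t : ℤ) : K :=
    if t = l then 0 else meanChoose ((t : K) - l + (j : ℕ)) (2 * j + 1)
  have hweights (z : Fin m → ℤ) : (∏ i, if z i = l then 1 / 2 else (1 : K)) *
      (Matrix.of fun i j : Fin m => meanChoose ((z i : K) - l + (j : ℕ)) (2 * j)).det =
        (Matrix.of fun i j => f j (z i)).det :=
    (Matrix.det_mul_column (fun i => if z i = l then 1 / 2 else (1 : K)) (Matrix.of _)).symm
  have hdiff (j : Fin m) (t : ℤ) (ht : t ≥ l) : f j t = G j (t + 1) - G j t := by
    have hshift : ((t + 1 : ℤ) : K) - l + (j : ℕ) = (t - l + (j : ℕ)) + 1 := by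
      push_cast
      ring
    simp only [f, G, (Int.lt_add_one_of_le ht).ne', if_false, hshift]
    split_ifs with h
    · rw [h, sub_self, zero_add, sub_zero, meanChoose_natCast_add_one, one_div_mul_eq_div]
    · rw [one_mul, meanChoose_add_one_sub]
  simp_rw [hweights]
  rw [sum_interlacing_cons_det hy.monotone (G := G) (fun j => if_pos rfl) hdiff]
  congr 1
  ext i j
  exact if_neg (hy (Fin.succ_pos i)).ne'

theorem meanChoose_add_two_mul (x : K) (N : ℕ) :
    (N + 1) * (N + 2) * meanChoose (x + 1) (N + 2) = x * (x - N) * meanChoose x N := by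
  have h₁ := add_one_mul_choose_eq_mul_choose_sub_one (x + 1) (N + 1)
  have h₂ := add_one_mul_choose_eq_mul_choose_sub_one x (N + 1)
  have h₃ := add_one_mul_choose_eq_sub_mul_choose x N
  have h₄ := add_one_mul_choose_eq_sub_mul_choose (x - 1) N
  have h₅ := add_one_mul_choose_eq_mul_choose_sub_one x N
  rw [add_sub_cancel_right] at h₁
  push_cast at h₁ h₂
  rw [meanChoose, meanChoose, add_sub_cancel_right]
  linear_combination (N + 1) / 2 * (h₁ + h₂) + x / 2 * (h₃ + h₄) + h₅ / 2

theorem meanChoose_add_natCast (x : K) (j : ℕ) :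
    meanChoose (x + j) (2 * j) =
      ((2 * j).factorial : K)⁻¹ * ∏ i ∈ Finset.range j, (x ^ 2 - (i : K) ^ 2) := by
  induction j with
  | zero => simp
  | succ j ih =>
    have h := meanChoose_add_two_mul (x + j) (2 * j)
    have h₁ : (2 * j + 1 : K) ≠ 0 := by exact_mod_cast (2 * j).succ_ne_zero
    have h₂ : (2 * j + 1 + 1 : K) ≠ 0 := by exact_mod_cast (2 * j + 1).succ_ne_zero
    have h₃ : ((2 * j).factorial : K) ≠ 0 := by exact_mod_cast (2 * j).factorial_ne_zero
    rw [Finset.prod_range_succ, mul_add_one, Nat.factorial_succ, Nat.factorial_succ]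
    push_cast at h ⊢
    rw [ih] at h
    rw [← add_assoc]
    field_simp at h ⊢
    linear_combination h

theorem H₂_two_mul (m : ℕ) : H₂ (2 * m) = ∏ j : Fin m, (2 * j : ℕ).factorial := by
  induction m with
  | zero => rfl
  | succ m ih =>
    rw [mul_add_one, H₂, ih, Fin.prod_univ_castSucc]
    rfl

theorem det_meanChoose {m : ℕ} (x : Fin m → K) :
    (Matrix.of fun i j : Fin m => meanChoose (x i + (j : ℕ)) (2 * j)).det =
      (H₂ (2 * m) : K)⁻¹ * ∏ i, ∏ j ∈ Finset.Ioi i, (x j ^ 2 - x i ^ 2) := by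
  let p (j : Fin m) : Polynomial K :=
    ∏ i ∈ Finset.range j, (Polynomial.X - Polynomial.C ((i : K) ^ 2))
  have hmonic (j : Fin m) : (p j).Monic := Polynomial.monic_prod_X_sub_C _ _
  have hdegree (j : Fin m) : (p j).natDegree = j := by
    simp only [p, Polynomial.natDegree_finsetProd_X_sub_C_eq_card, Finset.card_range]
  have hentry (i j : Fin m) : meanChoose (x i + (j : ℕ)) (2 * j) =
      ((2 * j : ℕ).factorial : K)⁻¹ * Matrix.of (fun i j => (p j).eval (x i ^ 2)) i j := by
    simp [meanChoose_add_natCast, p, Polynomial.eval_prod]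
  simp_rw [hentry]
  rw [Matrix.det_mul_row, H₂_two_mul, Nat.cast_prod, Finset.prod_inv_distrib,
    ← Matrix.det_vandermonde, Matrix.det_eval_matrixOfPolynomials_eq_det_vandermonde _ p hdegree
      hmonic]

end MeanChoose

section Trapezoid

variable {k n : ℕ} {i i' j r l c : ℤ} {S : Finset ℤ}

theorem up_mem_trapezoid :
    up i j ∈ trapezoid k n ↔ 0 ≤ j ∧ j + 2 ≤ 2 * k ∧ -(j / 2) ≤ i ∧ i < n + k - j := by
  simp only [mem_trapezoid, up, vertices, InTrapezoid, zigzag, Finset.mem_insert,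
    Finset.mem_singleton, forall_eq_or_imp, forall_eq]
  omega

theorem down_mem_trapezoid :
    down i j ∈ trapezoid k n ↔
      0 ≤ j ∧ j + 2 ≤ 2 * k ∧ -((j + 1) / 2) ≤ i ∧ i + 1 < n + k - j := by
  simp only [mem_trapezoid, down, vertices, InTrapezoid, zigzag, Finset.mem_insert,
    Finset.mem_singleton, forall_eq_or_imp, forall_eq]
  omega

theorem isRow_trapezoid (hr : 0 ≤ r) (hrk : r + 2 ≤ 2 * k) (hl : -((r + 1) / 2) ≤ l) :
    IsRow (trapezoid k n) r l (n + k - r - 1) := by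
  intro i hi
  rw [down_mem_trapezoid, up_mem_trapezoid]
  omega

theorem above_trapezoid_eq_empty (hr : 2 * k ≤ r + 1) : above (trapezoid k n) r S = ∅ := by
  refine ext_up_down (fun i j => ?_) fun i j => ?_
  · simp only [up_mem_above, up_mem_trapezoid, Finset.notMem_empty, iff_false]
    omega
  · simp only [down_mem_above, down_mem_trapezoid, Finset.notMem_empty, iff_false]
    omega

theorem quarteredHexagon_eq_above (a : Fin k → ℕ) :
    quarteredHexagon k n a =
      above (trapezoid k n) 0 (Finset.univ.image fun i => (a i : ℤ) - 1) := by
  refine ext_up_down (fun i j => ?_) fun i j => ?_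
  · simp only [quarteredHexagon, up_mem_above, Finset.mem_sdiff, up_mem_trapezoid,
      Finset.mem_image, Finset.mem_univ, true_and, up_inj]
    grind
  · simp only [quarteredHexagon, down_mem_above, Finset.mem_sdiff, down_mem_trapezoid,
      Finset.mem_image, Finset.mem_univ, up_ne_down, and_false, exists_false, not_false_eq_true,
      and_true]
    omega

theorem weight_up_down : weight k {up i j, down i' j} = 1 := by
  refine if_neg ?_
  rintro ⟨a, b, h, -⟩
  have hup : up a b ∈ ({up i j, down i' j} : Finset Tri) := h ▸ by simp
  have hdown : down a (b - 1) ∈ ({up i j, down i' j} : Finset Tri) := h ▸ by simp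
  simp only [Finset.mem_insert, Finset.mem_singleton, up_inj, down_inj, up_ne_down, down_ne_up,
    or_false, false_or] at hup hdown
  omega

theorem isWesternVertical_iff (hj : 0 ≤ j) (hmem : up i (j + 1) ∈ trapezoid k n) :
    IsWesternVertical k {down i j, up i (j + 1)} ↔ j % 2 = 1 ∧ i = -((j + 1) / 2) := by
  rw [up_mem_trapezoid] at hmem
  constructor
  · rintro ⟨a, b, h, hwest⟩
    have hup : up a b ∈ ({down i j, up i (j + 1)} : Finset Tri) := h ▸ by simp
    simp only [Finset.mem_insert, Finset.mem_singleton, up_inj, up_ne_down, false_or] at hup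
    obtain ⟨rfl, rfl⟩ := hup
    simp only [OnWesternSide, zigzag, Prod.mk.injEq, and_true] at hwest
    omega
  · intro h
    refine ⟨i, j + 1, by rw [Finset.pair_comm, add_sub_cancel_right], ?_⟩
    simp only [OnWesternSide, zigzag, Prod.mk.injEq, and_true]
    omega

theorem verticalWeight_trapezoid (hr : 0 ≤ r) (hmem : up c (r + 1) ∈ trapezoid k n) :
    verticalWeight (trapezoid k n) (weight k) r c =
      if r % 2 = 1 ∧ c = -((r + 1) / 2) then 1 / 2 else 1 := by
  rw [verticalWeight, if_pos hmem, weight]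
  simp only [isWesternVertical_iff hr hmem]

end Trapezoid

section TilingCounts

variable {k n m h : ℕ}

theorem weightedCount_above_even_eq_sum {x : Fin (m + 1) → ℤ} (hmk : m + h < k)
    (hx : StrictMono x) (hxl : -(h : ℤ) ≤ x 0) (hxu : x (Fin.last m) < n + k - 2 * h) :
    weightedCount (above (trapezoid k n) (2 * h) (Finset.univ.image x)) (weight k) =
      ∑ y ∈ interlacing x,
        weightedCount (above (trapezoid k n) (2 * h + 1) (Finset.univ.image y)) (weight k) := by
  have hx0 : x 0 ∈ Finset.univ.image x := Finset.mem_image_of_mem _ (Finset.mem_univ 0)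
  have hx0last : x 0 ≤ x (Fin.last m) := hx.monotone (Fin.zero_le _)
  rw [← scan_empty_eq_above (p := 2 * -h)
      (fun i hi _ => by rw [up_mem_trapezoid] at hi; omega)
      (fun i hi => by rw [down_mem_trapezoid] at hi; omega),
    weightedCount_scan_skip (fun _ _ => weight_up_down) hxl hx0 fun i hli hi => ?_,
    weightedCount_scan_eq_sum_interlacing (fun _ _ => weight_up_down) hx
      (isRow_trapezoid (by omega) (by omega) (by omega)) (by omega) (fun i _ => by simp) (by simp)]
  · refine Finset.sum_congr rfl fun y hy => ?_
    rw [Finset.prod_eq_one, one_mul, Finset.empty_union]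
    intro i _
    obtain ⟨hle, hlt⟩ := mem_interlacing.1 hy i
    have hi0 := hx.monotone (Fin.zero_le i.castSucc)
    have hilast := hx.monotone (Fin.le_last i.succ)
    have hm := i.pos
    rw [verticalWeight_trapezoid (by omega) (up_mem_trapezoid.2 (by omega)), if_neg (by omega)]
  · have hiS : i ∉ Finset.univ.image x := by
      simp only [Finset.mem_image, Finset.mem_univ, true_and, not_exists]
      exact fun j => (hi.trans_le (hx.monotone (Fin.zero_le j))).ne'
    exact ⟨up_mem_trapezoid.2 (by omega), down_mem_trapezoid.2 (by omega), hiS⟩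

/-- Rows of odd height start with a down-pointing triangle, like the part of a row that follows a
dent. A virtual dent just outside the western side therefore starts the scan, and the number of
dents does not drop. -/
theorem weightedCount_above_odd_eq_sum {y : Fin (m + 1) → ℤ} (hmk : m + 1 + h < k)
    (hy : StrictMono (Fin.cons (-(h + 1 : ℤ)) y : Fin (m + 2) → ℤ))
    (hyu : y (Fin.last m) < n + k - (2 * h + 1)) :
    weightedCount (above (trapezoid k n) (2 * h + 1) (Finset.univ.image y)) (weight k) =
      ∑ z ∈ interlacing (Fin.cons (-(h + 1 : ℤ)) y : Fin (m + 2) → ℤ),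
        (∏ i, if z i = -(h + 1 : ℤ) then 1 / 2 else 1) *
          weightedCount (above (trapezoid k n) (2 * (h + 1 : ℕ)) (Finset.univ.image z))
            (weight k) := by
  set x : Fin (m + 2) → ℤ := Fin.cons (-(h + 1 : ℤ)) y with hxdef
  have hx0 : x 0 = -(h + 1 : ℤ) := rfl
  have hxlast : x (Fin.last (m + 1)) = y (Fin.last m) := rfl
  have hS : ∀ i > x 0, i ∈ Finset.univ.image y ↔ i ∈ Set.range x := by
    intro i hi
    have hne : i ≠ -(h + 1 : ℤ) := (hx0 ▸ hi).ne'
    simp only [hxdef, Fin.range_cons, Set.mem_insert_iff, hne, false_or, Finset.mem_image,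
      Finset.mem_univ, true_and, Set.mem_range]
  rw [← scan_empty_eq_above (p := 2 * x 0 + 1)
      (fun i hi _ => by rw [up_mem_trapezoid] at hi; omega)
      (fun i hi => by rw [down_mem_trapezoid] at hi; omega),
    weightedCount_scan_eq_sum_interlacing (fun _ _ => weight_up_down) hy
      (isRow_trapezoid (by omega) (by omega) (by omega)) (by omega) hS (by simp)]
  refine Finset.sum_congr rfl fun z hz => ?_
  have hheight : (2 * h + 1 + 1 : ℤ) = 2 * (h + 1 : ℕ) := by
    push_cast
    ring
  rw [Finset.empty_union, hheight]
  congr 1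
  refine Finset.prod_congr rfl fun i _ => ?_
  obtain ⟨hle, hlt⟩ := mem_interlacing.1 hz i
  have hi0 := hy.monotone (Fin.zero_le i.castSucc)
  have hilast := hy.monotone (Fin.le_last i.succ)
  rw [verticalWeight_trapezoid (by omega) (up_mem_trapezoid.2 (by omega))]
  exact if_congr (by omega) rfl rfl

theorem weightedCount_above_odd_eq_det
    (heven : ∀ z : Fin m → ℤ, StrictMono z → (∀ i, -((h + 1 : ℕ) : ℤ) ≤ z i) →
      (∀ i, z i < n + k - 2 * ((h + 1 : ℕ) : ℤ)) →
      weightedCount (above (trapezoid k n) (2 * (h + 1 : ℕ)) (Finset.univ.image z)) (weight k) =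
        (Matrix.of fun i j : Fin m => meanChoose ((z i : ℚ) + (h + 1 : ℕ) + (j : ℕ)) (2 * j)).det)
    {y : Fin m → ℤ} (hmk : m + h + 1 = k) (hy : StrictMono y) (hyl : ∀ i, -(h : ℤ) ≤ y i)
    (hyu : ∀ i, y i < n + k - (2 * h + 1)) :
    weightedCount (above (trapezoid k n) (2 * h + 1) (Finset.univ.image y)) (weight k) =
      (Matrix.of fun i j : Fin m =>
        meanChoose ((y i : ℚ) + (h + 1) + (j : ℕ)) (2 * j + 1)).det := by
  obtain _ | m := m
  · rw [above_trapezoid_eq_empty (by omega), weightedCount_empty, Matrix.det_fin_zero]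
  have hcons : StrictMono (Fin.cons (-(h + 1 : ℤ)) y : Fin (m + 2) → ℤ) :=
    hy.vecCons (by have := hyl 0; omega)
  rw [weightedCount_above_odd_eq_sum (by omega) hcons (hyu _)]
  have hdet := sum_interlacing_cons_det_meanChoose (K := ℚ) hcons
  push_cast [sub_neg_eq_add] at hdet
  rw [← hdet]
  refine Finset.sum_congr rfl fun z hz => ?_
  rw [heven z (strictMono_of_mem_interlacing hcons.monotone hz) (fun i => ?_) fun i => ?_]
  · push_cast
    rfl
  · exact_mod_cast (hcons.monotone (Fin.zero_le _)).trans (mem_interlacing.1 hz i).1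
  · have hlt : z i < y i := (mem_interlacing.1 hz i).2
    have := hyu i
    omega

theorem weightedCount_above_even_eq_det {x : Fin m → ℤ} (hmk : m + h = k) (hx : StrictMono x)
    (hxl : ∀ i, -(h : ℤ) ≤ x i) (hxu : ∀ i, x i < n + k - 2 * (h : ℤ)) :
    weightedCount (above (trapezoid k n) (2 * h) (Finset.univ.image x)) (weight k) =
      (Matrix.of fun i j : Fin m => meanChoose ((x i : ℚ) + h + (j : ℕ)) (2 * j)).det := by
  induction m generalizing h with
  | zero => rw [above_trapezoid_eq_empty (by omega), weightedCount_empty, Matrix.det_fin_zero]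
  | succ m ih =>
    rw [weightedCount_above_even_eq_sum (by omega) hx (hxl 0) (hxu _),
      ← sum_interlacing_det_meanChoose hx.monotone]
    refine Finset.sum_congr rfl fun y hy => ?_
    refine weightedCount_above_odd_eq_det (fun z => ih (by omega)) (by omega)
      (strictMono_of_mem_interlacing hx.monotone hy) (fun i => ?_) fun i => ?_
    · exact (hxl _).trans (mem_interlacing.1 hy i).1
    · have := (mem_interlacing.1 hy i).2
      have := hxu i.succ
      omega

end TilingCounts

end Lozenge

theorem mainTheorem7 (k n : ℕ) (hk : 1 ≤ k) (a : Fin k → ℕ) (ha : StrictMono a)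
    (ha_pos : ∀ i, 1 ≤ a i) (ha_le : ∀ i, a i ≤ n + k) :
    Lozenge.weightedCount (Lozenge.quarteredHexagon k n a) (Lozenge.weight k) =
      1 / (Lozenge.H₂ (2 * k) : ℚ) *
        (∏ i : Fin k, ∏ j ∈ Finset.Ioi i, ((a j : ℚ) - (a i : ℚ))) *
        (∏ i : Fin k, ∏ j ∈ Finset.Ioi i, ((a i : ℚ) + (a j : ℚ) - 2)) := by
  have hx : StrictMono fun i => (a i : ℤ) - 1 := fun i j hij => by
    simpa using ha hij
  have hdet : Lozenge.weightedCount (Lozenge.quarteredHexagon k n a) (Lozenge.weight k) =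
      (Matrix.of fun i j : Fin k =>
        Lozenge.meanChoose ((a i : ℚ) - 1 + (j : ℕ)) (2 * j)).det := by
    rw [Lozenge.quarteredHexagon_eq_above]
    have h := Lozenge.weightedCount_above_even_eq_det (n := n) (h := 0) (add_zero k) hx
      (fun i => by have := ha_pos i; omega) (fun i => by have := ha_le i; omega)
    simpa using h
  rw [hdet, Lozenge.det_meanChoose, one_div, mul_assoc]
  simp_rw [← Finset.prod_mul_distrib]
  congr 1
  refine Finset.prod_congr rfl fun i _ => Finset.prod_congr rfl fun j _ => ?_
  ring
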